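/- Let $k$ be an algebraically closed field of characteristic $0$. A fusion category is a $k$-linear abelian semisimple rigid monoidal category with $k$-bilinear tensor product, finitely many isomorphism classes of simple objects, finite-dimensional spaces of morphisms and simple unit object $\mathbf 1$. A simple object $X$ is invertible if $X\otimes X^*\cong\mathbf 1$, and $G=G(\mathcal C)$ denotes the group of isomorphism classes of invertible objects of $\mathcal C$. A fusion category is non-pointed if it has a non-invertible simple object. A generalized near-group fusion category is a non-pointed fusion category $\mathcal C$ such that $G$ acts transitively, by left tensor product, on the set $\{X_1,\dots,X_n\}$ of isomorphism classes of non-invertible simple objects. It is of type $(G,\Gamma,k_1,\dots,k_n)$ if $\Gamma$ is the stabilizer of $X_1$ in $G$ and $k_i=\dim\operatorname{Hom}(X_i,X_1\otimes X_1^*)$, so that $X_1\otimes X_1^*\cong\bigoplus_{h\in\Gamma}h\oplus k_1X_1\oplus\dots\oplus k_nX_n$. A generalized Tambara–Yamagami fusion category is a non-pointed fusion category in which the tensor product of any two non-invertible simple objects is a direct sum of invertible simple objects. For a fusion category $\mathcal D$, the adjoint subcategory $\mathcal D_{ad}$ is the fusion subcategory generated by the simple objects occurring in $X\otimes X^*$,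 $X$ simple. The universal grading group $\mathcal U(\mathcal D)$ is the group generated by symbols $[X]$, $X$ simple, with relations $[X][Y]=[Z]$ whenever the simple object $Z$ occurs in $X\otimes Y$; in the universal grading, $\mathcal D_u$ (for $u\in\mathcal U(\mathcal D)$) consists of the objects all of whose simple constituents $Z$ satisfy $[Z]=u$. **Theorem.** Let $\mathcal C$ be a generalized near-group fusion category of type $(G,\Gamma,k_1,\dots,k_n)$. (1) If $(k_1,\dots,k_n)=(0,\dots,0)$, then $\mathcal C$ is a generalized Tambara–Yamagami fusion category. (2) If $(k_1,\dots,k_n)\neq(0,\dots,0)$, then $\mathcal C_{ad}$ is a generalized near-group fusion category (in particular non-pointed); $\mathcal U(\mathcal C)$ is finite and the universal grading $\mathcal C=\bigoplus_{u\in\mathcal U(\mathcal C)}\mathcal C_u$ is a faithful grading with trivial component $\mathcal C_1=\mathcal C_{ad}$, so that $\mathcal C$ is a $\mathcal U(\mathcal C)$-extension of $\mathcal C_{ad}$; $\mathcal C_{ad}=\mathcal C$ if and only if $\mathcal U(\mathcal C)$ is trivial; and the universal grading of $\mathcal C_{ad}$ is trivial, i.e. $\mathcal U(\mathcal C_{ad})=1$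 and $(\mathcal C_{ad})_{ad}=\mathcal C_{ad}$. -/

import Mathlib

open CategoryTheory CategoryTheory.Limits CategoryTheory.MonoidalCategory

universe v u w

namespace GenNearGroup

section Basic

variable {C : Type u} [Category.{v} C]

/-- `X` is a finite (possibly empty) direct sum of objects satisfying `P`. -/
def IsDirectSumOf [HasZeroMorphisms C] (P : ObjectProperty C) (X : C) : Prop :=
  ∃ (m : ℕ) (S : Fin m → C) (b : Bicone S),
    Nonempty b.IsBilimit ∧ (∀ i, P (S i)) ∧ Nonempty (b.pt ≅ X)

/-- `Z` is a simple object occurring in `W`. In a semisimple category this says that `Z` is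
(isomorphic to) a simple direct summand of `W`. -/
def IsConstituent [HasZeroMorphisms C] (Z W : C) : Prop :=
  Simple Z ∧ ∃ f : Z ⟶ W, f ≠ 0

/-- `Y` is a dual `X^*` of `X`, with evaluation `X^* ⊗ X ⟶ 𝟙` and coevaluation
`𝟙 ⟶ X ⊗ X^*`. Such a `Y` is unique up to isomorphism. -/
def IsDual [MonoidalCategory C] (X Y : C) : Prop :=
  Nonempty (ExactPairing X Y)

/-- `X ⊗ X^* ≅ 𝟙`. -/
def IsInvertible [MonoidalCategory C] (X : C) : Prop :=
  ∃ Y : C, IsDual X Y ∧ Nonempty (X ⊗ Y ≅ 𝟙_ C)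

/-- `X` is a non-invertible simple object. -/
def IsNonInvSimple [HasZeroMorphisms C] [MonoidalCategory C] (X : C) : Prop :=
  Simple X ∧ ¬ IsInvertible X

end Basic

/-- The group `G(C)` of isomorphism classes of invertible objects, multiplication being the tensor
product: the units of the monoid of all isomorphism classes of objects. -/
abbrev InvGroup (C : Type u) [Category.{v} C] [MonoidalCategory C] : Type u :=
  (Skeleton C)ˣ

section Fusion

variable (k : Type w) [Field k]
variable (C : Type u) [Category.{v} C] [Preadditive C] [Linear k C] [MonoidalCategory C]
  [MonoidalPreadditive C] [MonoidalLinear k C]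

/-- Fusion categories over `k`: `C` is a `k`-linear category with `k`-bilinear tensor product
(the type class arguments) which is abelian, rigid and semisimple, has finitely many simple objects
up to isomorphism, finite-dimensional spaces of morphisms, and a simple unit object. -/
@[nolint unusedArguments]
structure IsFusionCategory : Prop where
  /-- The next five fields say that `C` is abelian. -/
  hasFiniteProducts : HasFiniteProducts C
  hasKernels : HasKernels C
  hasCokernels : HasCokernels C
  normalMono : IsNormalMonoCategory C
  normalEpi : IsNormalEpiCategory C
  /-- Every object has a dual on both sides. -/
  rigid : ∀ X : C, (∃ Y, IsDual X Y) ∧ (∃ Y, IsDual Y X)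
  /-- Every object is a finite direct sum of simple objects. -/
  semisimple : ∀ X : C, IsDirectSumOf (fun Y => Simple Y) X
  /-- There are finitely many simple objects up to isomorphism. -/
  finiteSimples : ∃ (m : ℕ) (S : Fin m → C), ∀ X : C, Simple X → ∃ i, Nonempty (X ≅ S i)
  finiteHom : ∀ X Y : C, Module.Finite k (X ⟶ Y)
  unitSimple : Simple (𝟙_ C)

/-- Generalized near-group fusion categories: non-pointed fusion categories in which `G(C)` acts
transitively, by left tensor product, on the isomorphism classes of non-invertible simple
objects. -/
structure IsGeneralizedNearGroup : Prop where
  fusion : IsFusionCategory k C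
  nonPointed : ∃ X : C, IsNonInvSimple X
  transitive : ∀ X Y : C, IsNonInvSimple X → IsNonInvSimple Y →
    ∃ g : InvGroup C, (g : Skeleton C) * toSkeleton X = toSkeleton Y

/-- `C` is a generalized near-group fusion category of type `(G(C), Γ, κ₁, …, κₙ)`:
for an enumeration `X₁, …, Xₙ` of the isomorphism classes of non-invertible simple objects,
`Γ` is the stabilizer of `X₁` in `G(C)`, and `κᵢ = dim Hom (Xᵢ, X₁ ⊗ X₁^*)` is the multiplicity
of `Xᵢ` in `X₁ ⊗ X₁^*`. -/
structure IsGeneralizedNearGroupOfType {n : ℕ} (Γ : Subgroup (InvGroup C)) (κ : Fin n → ℕ) :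
    Prop where
  isGeneralizedNearGroup : IsGeneralizedNearGroup k C
  exists_data : ∃ (hn : 0 < n) (X : Fin n → C) (D : C),
    (∀ i, IsNonInvSimple (X i)) ∧
    (∀ i j, Nonempty (X i ≅ X j) → i = j) ∧
    (∀ Y : C, IsNonInvSimple Y → ∃ i, Nonempty (Y ≅ X i)) ∧
    Γ = MulAction.stabilizer (InvGroup C) (toSkeleton (X ⟨0, hn⟩)) ∧
    IsDual (X ⟨0, hn⟩) D ∧
    ∀ i, κ i = Module.finrank k (X i ⟶ X ⟨0, hn⟩ ⊗ D)

/-- Generalized Tambara–Yamagami fusion categories: non-pointed fusion categories in which the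
tensor product of any two non-invertible simple objects is a direct sum of invertible simple
objects. -/
structure IsGeneralizedTambaraYamagami : Prop where
  fusion : IsFusionCategory k C
  nonPointed : ∃ X : C, IsNonInvSimple X
  tensor : ∀ X Y : C, IsNonInvSimple X → IsNonInvSimple Y →
    IsDirectSumOf (fun Z => Simple Z ∧ IsInvertible Z) (X ⊗ Y)

end Fusion

section Subcategories

variable {C : Type u} [Category.{v} C] [Preadditive C] [MonoidalCategory C]

/-- The full subcategory of the objects satisfying `P` is a fusion subcategory: it contains the
unit object and is closed under tensor products, direct summands (hence isomorphisms), finite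
direct sums and duals. -/
structure IsFusionSubcategory (P : ObjectProperty C) : Prop where
  unit : P (𝟙_ C)
  tensor : ∀ X Y : C, P X → P Y → P (X ⊗ Y)
  retract : ∀ X Y : C, Nonempty (Retract X Y) → P Y → P X
  directSum : ∀ X : C, IsDirectSumOf P X → P X
  dual : ∀ X Y : C, IsDual X Y → (P X ↔ P Y)

variable (C) in
/-- The objects of the adjoint subcategory `C_ad`, the smallest fusion subcategory of `C`
containing the simple objects occurring in `X ⊗ X^*`, for all simple `X`. -/
def adjointProp : ObjectProperty C := fun Y =>
  ∀ P : ObjectProperty C, IsFusionSubcategory P →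
    (∀ X D Z : C, Simple X → IsDual X D → IsConstituent Z (X ⊗ D) → P Z) → P Y

theorem adjointProp_isFusionSubcategory : IsFusionSubcategory (adjointProp C) where
  unit := fun _ hP _ => hP.unit
  tensor := fun X Y hX hY P hP h => hP.tensor X Y (hX P hP h) (hY P hP h)
  retract := fun X Y r hY P hP h => hP.retract X Y r (hY P hP h)
  directSum := by
    rintro X ⟨m, S, b, hb, hS, hX⟩ P hP h
    exact hP.directSum X ⟨m, S, b, hb, fun i => hS i P hP h, hX⟩
  dual := fun X Y hXY =>
    ⟨fun hX P hP h => (hP.dual X Y hXY).1 (hX P hP h),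
      fun hY P hP h => (hP.dual X Y hXY).2 (hY P hP h)⟩

instance adjointProp_isMonoidal : (adjointProp C).IsMonoidal where
  prop_unit := adjointProp_isFusionSubcategory.unit
  prop_tensor := adjointProp_isFusionSubcategory.tensor

variable (C) in
/-- The adjoint subcategory `C_ad`, as a full monoidal subcategory of `C`. -/
abbrev AdjointSubcategory : Type u := (adjointProp C).FullSubcategory

/-- `C = ⨁_{g ∈ G} C_g` is a grading of `C` by the finite group `G`, where `C_g` is the full
subcategory (closed under isomorphisms) of the objects satisfying `comp g`. -/
structure IsGrading {G : Type*} [Group G] (comp : G → ObjectProperty C) : Prop where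
  finite : Finite G
  iso : ∀ (g : G) (X Y : C), Nonempty (X ≅ Y) → comp g X → comp g Y
  /-- Distinct components are orthogonal. -/
  orthogonal : ∀ (g h : G) (X Y : C), g ≠ h → comp g X → comp h Y → ∀ f : X ⟶ Y, f = 0
  /-- Every object is the direct sum of its homogeneous components. -/
  decomposition : ∀ X : C, ∃ (S : G → C) (b : Bicone S),
    Nonempty b.IsBilimit ∧ (∀ g, comp g (S g)) ∧ Nonempty (b.pt ≅ X)
  tensor : ∀ (g h : G) (X Y : C), comp g X → comp h Y → comp (g * h) (X ⊗ Y)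
  dual : ∀ (g : G) (X Y : C), IsDual X Y → (comp g X ↔ comp g⁻¹ Y)

/-- Every component of the grading is non-zero. -/
def IsFaithfulGrading {G : Type*} (comp : G → ObjectProperty C) : Prop :=
  ∀ g, ∃ X : C, comp g X ∧ ¬ IsZero X

variable (C) in
/-- The universal grading group `U(C)`: it has one generator `[X]` for each simple object `X`, and
a relation `[X] [Y] = [Z]` whenever the simple object `Z` occurs in `X ⊗ Y` (in particular
isomorphic simple objects have the same class). Thus homomorphisms from `U(C)` to a group `H` are
the assignments of degrees in `H` to the simple objects that are compatible with `⊗`. -/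
abbrev UniversalGradingGroup : Type u :=
  PresentedGroup {r : FreeGroup {X : C // Simple X} |
    ∃ X Y Z : {X : C // Simple X}, IsConstituent Z.1 (X.1 ⊗ Y.1) ∧
      r = FreeGroup.of X * FreeGroup.of Y * (FreeGroup.of Z)⁻¹}

/-- The class in `U(C)` of a simple object. -/
def universalDegree (X : C) (hX : Simple X) : UniversalGradingGroup C :=
  PresentedGroup.of ⟨X, hX⟩

variable (C) in
/-- The universal grading: `C_u` consists of the objects all of whose simple constituents have
class `u`. -/
def universalGrading (u : UniversalGradingGroup C) : ObjectProperty C := fun X =>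
  ∀ (Z : C) (hZ : Simple Z), IsConstituent Z X → universalDegree Z hZ = u

end Subcategories

end GenNearGroup

/-!
Call a simple object `Z` with a nonzero morphism to `W` a constituent of `W`. In a fusion category
constituents are retracts (`IsFusionCategory.retract_of_isConstituent`), an object lies in a fusion
subcategory if and only if its constituents do, and rigidity gives Frobenius reciprocity
(`isConstituent_tensor_left_iff`, `isConstituent_tensor_right_iff`): for simple `A`, `B`, the object
`A` occurs in `X ⊗ B` if and only if `B` occurs in `X^* ⊗ A`. The whole argument is carried out with
the relation of occurrence; multiplicities enter only through being zero or not.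

*The universal grading.* For every fusion category the classes of simple objects exhaust the
universal grading group, because products of simple objects are nonzero and duals give inverses, so
the group is finite and the grading is faithful. That the trivial component is not larger than the
adjoint subcategory requires a group receiving the universal grading group in which only simple
objects of `C_ad` become trivial. It is the set of simple objects modulo the relation "`X` occurs in
`A ⊗ Y` for some `A` in `C_ad`" (`AdjointRel`). The product of classes is well defined because `C_ad`
is normal, `X ⊗ C_ad ⊆ C_ad ⊗ X` (`exists_adjointProp_tensor`), and because any two constituents of
`X ⊗ Y` are related (`adjointRel_of_isConstituent`).

*The near-group case.* Fix a non-invertible simple object `X₁`. By transitivity any other one is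
`L ⊗ X₁`, and any one is `L ⊗ X₁^*`, with `L` invertible. If `X₁ ⊗ X₁^*` is a sum of invertible
objects, a product `X ⊗ Y` of non-invertible simple objects becomes `X ⊗ L ⊗ X₁^* ≅ L' ⊗ X₁ ⊗ X₁^*`,
which is a sum of invertible objects too. Otherwise `C_ad` contains a non-invertible simple object
`X₀`. An invertible `L` with `L ⊗ X ≅ Y` occurs in `Y ⊗ X^*`, so transitivity is inherited by `C_ad`
(`IsGeneralizedNearGroup.fullSubcategory`). Moreover `X ⊗ X^* ≅ X₀ ⊗ X₀^*` for every
non-invertible simple `X` of `C` (`IsGeneralizedNearGroup.tensor_dual_iso`), so the generators of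
`C_ad` already lie in `(C_ad)_ad`, and the general theory applied to `C_ad` shows that its universal
grading is trivial.
-/

namespace GenNearGroup

/-! ### Semisimplicity -/

section Semisimple

variable {C : Type u} [Category.{v} C] [Preadditive C]

/-- Direct sum decompositions in terms of inclusions and projections. -/
theorem isDirectSumOf_iff {P : ObjectProperty C} {X : C} :
    IsDirectSumOf P X ↔ ∃ (m : ℕ) (S : Fin m → C) (ι : ∀ i, S i ⟶ X) (π : ∀ i, X ⟶ S i),
      (∀ i, P (S i)) ∧ (∀ i, ι i ≫ π i = 𝟙 _) ∧ (∀ i j, i ≠ j → ι i ≫ π j = 0) ∧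
      ∑ i, π i ≫ ι i = 𝟙 X := by
  constructor
  · rintro ⟨m, S, b, ⟨hb⟩, hS, ⟨e⟩⟩
    refine ⟨m, S, fun i => b.ι i ≫ e.hom, fun i => e.inv ≫ b.π i, hS, fun i => by simp,
      fun i j hij => by simp [bicone_ι_π_ne b hij], ?_⟩
    have h := congrArg (fun f => e.inv ≫ f ≫ e.hom) (IsBilimit.total hb)
    simpa [Preadditive.comp_sum, Preadditive.sum_comp] using h
  · rintro ⟨m, S, ι, π, hS, h1, h0, hπι⟩
    let b : Bicone S :=
      { pt := X
        π := π
        ι := ι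
        ι_π := fun i j => by
          split_ifs with h
          · subst h
            simp [h1]
          · exact h0 i j h }
    exact ⟨m, S, b, ⟨isBilimitOfTotal b hπι⟩, hS, ⟨Iso.refl _⟩⟩

theorem IsDirectSumOf.mono {P Q : ObjectProperty C} (h : ∀ X, P X → Q X) {X : C}
    (hX : IsDirectSumOf P X) : IsDirectSumOf Q X := by
  obtain ⟨m, S, b, hb, hS, hX⟩ := hX
  exact ⟨m, S, b, hb, fun i => h _ (hS i), hX⟩

theorem Simple.isConstituent_self {X : C} (hX : Simple X) : IsConstituent X X :=
  ⟨hX, 𝟙 X, id_nonzero X⟩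

theorem IsConstituent.of_retract {Z W : C} (hZ : Simple Z) (r : Retract Z W) :
    IsConstituent Z W := by
  refine ⟨hZ, r.i, fun h => id_nonzero Z ?_⟩
  rw [← r.retract, h, zero_comp]

theorem IsConstituent.exists_of_isDirectSumOf {P : ObjectProperty C} {X Z : C}
    (hX : IsDirectSumOf P X) (hZ : IsConstituent Z X) : ∃ Y, P Y ∧ IsConstituent Z Y := by
  obtain ⟨hZ, f, hf⟩ := hZ
  obtain ⟨m, S, ι, π, hS, -, -, h2⟩ := isDirectSumOf_iff.1 hX
  have h : ∑ i, (f ≫ π i) ≫ ι i ≠ 0 := by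
    simpa only [Category.assoc, ← Preadditive.comp_sum, h2, Category.comp_id] using hf
  obtain ⟨i, -, hi⟩ := Finset.exists_ne_zero_of_sum_ne_zero h
  exact ⟨S i, hS i, hZ, f ≫ π i, fun h0 => hi (by rw [h0, zero_comp])⟩

end Semisimple

section Fusion

variable {k : Type w} [Field k] {C : Type u} [Category.{v} C] [Preadditive C] [Linear k C]
  [MonoidalCategory C]

namespace IsFusionCategory

variable (hC : IsFusionCategory k C)

include hC


/-- The abelian structure of a fusion category. -/
@[reducible]
noncomputable def abelian : Abelian C :=
  { ‹Preadditive C›, hC.normalMono, hC.normalEpi with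
    has_finite_products := hC.hasFiniteProducts
    has_kernels := hC.hasKernels
    has_cokernels := hC.hasCokernels }

theorem isIso_of_ne_zero {X Y : C} (hX : Simple X) (hY : Simple Y) {f : X ⟶ Y} (hf : f ≠ 0) :
    IsIso f :=
  have := hC.hasKernels
  isIso_of_hom_simple hf

/-- A decomposition of an object into simple objects, with inclusions and projections. -/
theorem exists_decomposition (X : C) :
    ∃ (m : ℕ) (S : Fin m → C) (ι : ∀ i, S i ⟶ X) (π : ∀ i, X ⟶ S i),
      (∀ i, Simple (S i)) ∧ (∀ i, ι i ≫ π i = 𝟙 _) ∧ ∑ i, π i ≫ ι i = 𝟙 X := by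
  obtain ⟨m, S, ι, π, hS, h1, -, h2⟩ := isDirectSumOf_iff.1 (hC.semisimple X)
  exact ⟨m, S, ι, π, hS, h1, h2⟩

/-- A nonzero morphism into `X` has a nonzero component along some simple summand of `X`,
even after applying an additive operation. -/
theorem exists_retract_of_ne_zero {X A B : C} (F : (X ⟶ X) →+ (A ⟶ B)) (hF : F (𝟙 X) ≠ 0) :
    ∃ (S : C) (r : Retract S X), Simple S ∧ F (r.r ≫ r.i) ≠ 0 := by
  obtain ⟨m, S, ι, π, hS, h1, h2⟩ := hC.exists_decomposition X
  rw [← h2, map_sum] at hF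
  obtain ⟨i, -, hi⟩ := Finset.exists_ne_zero_of_sum_ne_zero hF
  exact ⟨S i, ⟨ι i, π i, h1 i⟩, hS i, hi⟩

theorem isSplitMono_of_simple {Z W : C} (hZ : Simple Z) {f : Z ⟶ W} (hf : f ≠ 0) :
    IsSplitMono f := by
  obtain ⟨S, r, hS, h⟩ := hC.exists_retract_of_ne_zero (Preadditive.leftComp W f)
    (by simpa [Preadditive.leftComp] using hf)
  have h' : f ≫ r.r ≠ 0 := fun h0 => h (by simp [Preadditive.leftComp, reassoc_of% h0])
  have := hC.isIso_of_ne_zero hZ hS h'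
  exact ⟨⟨r.r ≫ inv (f ≫ r.r), by rw [← Category.assoc, IsIso.hom_inv_id]⟩⟩

theorem isSplitEpi_of_simple {Z W : C} (hZ : Simple Z) {f : W ⟶ Z} (hf : f ≠ 0) :
    IsSplitEpi f := by
  obtain ⟨S, r, hS, h⟩ := hC.exists_retract_of_ne_zero (Preadditive.rightComp W f)
    (by simpa [Preadditive.rightComp] using hf)
  have h' : r.i ≫ f ≠ 0 := fun h0 => h (by simp [Preadditive.rightComp, h0])
  have := hC.isIso_of_ne_zero hS hZ h'
  exact ⟨⟨inv (r.i ≫ f) ≫ r.i, by rw [Category.assoc, IsIso.inv_hom_id]⟩⟩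

/-- Constituents of `W` are the same as simple retracts of `W`. -/
theorem retract_of_isConstituent {Z W : C} (h : IsConstituent Z W) : Nonempty (Retract Z W) := by
  obtain ⟨hZ, f, hf⟩ := h
  have := hC.isSplitMono_of_simple hZ hf
  exact ⟨⟨f, retraction f, IsSplitMono.id f⟩⟩

theorem isConstituent_of_hom_to {Z W : C} (hZ : Simple Z) {f : W ⟶ Z} (hf : f ≠ 0) :
    IsConstituent Z W := by
  have := hC.isSplitEpi_of_simple hZ hf
  exact .of_retract hZ ⟨section_ f, f, IsSplitEpi.id f⟩

theorem isConstituent_trans_retract {Z W W' : C} (h : IsConstituent Z W) (r : Retract W W') :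
    IsConstituent Z W' := by
  obtain ⟨r'⟩ := hC.retract_of_isConstituent h
  exact .of_retract h.1 (r'.trans r)

theorem isConstituent_congr {Z W W' : C} (h : IsConstituent Z W) (e : W ≅ W') :
    IsConstituent Z W' :=
  hC.isConstituent_trans_retract h (.ofIso e)

theorem iso_of_isConstituent {Z W : C} (h : IsConstituent Z W) (hW : Simple W) :
    Nonempty (Z ≅ W) := by
  obtain ⟨hZ, f, hf⟩ := h
  have := hC.isIso_of_ne_zero hZ hW hf
  exact ⟨asIso f⟩

theorem exists_isConstituent {W : C} (hW : ¬ IsZero W) : ∃ Z, IsConstituent Z W := by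
  obtain ⟨S, r, hS, -⟩ := hC.exists_retract_of_ne_zero (AddMonoidHom.id (W ⟶ W))
    (fun h => hW ((IsZero.iff_id_eq_zero W).2 h))
  exact ⟨S, .of_retract hS r⟩

/-- An object all of whose constituents satisfy `P` is a direct sum of simple objects
satisfying `P`. -/
theorem isDirectSumOf_of_isConstituent {P : ObjectProperty C} {X : C}
    (h : ∀ Z, IsConstituent Z X → P Z) : IsDirectSumOf P X := by
  obtain ⟨m, S, ι, π, hS, h1, h0, h2⟩ := isDirectSumOf_iff.1 (hC.semisimple X)
  refine isDirectSumOf_iff.2 ⟨m, S, ι, π, fun i => ?_, h1, h0, h2⟩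
  exact h _ (.of_retract (hS i) ⟨ι i, π i, h1 i⟩)

/-- Every object of a fusion category is projective: it suffices to lift simple summands along an
epimorphism, and a nonzero morphism onto a simple object splits. -/
theorem isSplitEpi_of_epi {X Y : C} (g : Y ⟶ X) [Epi g] : IsSplitEpi g := by
  let := hC.abelian
  obtain ⟨m, S, ι, π, hS, h1, h2⟩ := hC.exists_decomposition X
  have h : ∀ i, ∃ l : S i ⟶ Y, l ≫ g = ι i := fun i => by
    have := hS i
    have hne : pullback.fst (ι i) g ≠ 0 := fun h0 => by
      exact Simple.not_isZero (S i) (IsZero.of_epi_eq_zero _ h0)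
    have := hC.isSplitEpi_of_simple (hS i) hne
    exact ⟨section_ (pullback.fst (ι i) g) ≫ pullback.snd (ι i) g, by
      rw [Category.assoc, ← pullback.condition, ← Category.assoc, IsSplitEpi.id, Category.id_comp]⟩
  choose l hl using h
  refine ⟨⟨∑ i, π i ≫ l i, ?_⟩⟩
  simp only [Preadditive.sum_comp, Category.assoc, hl, h2]

/-- Every object of a fusion category is injective. -/
theorem isSplitMono_of_mono {X Y : C} (f : X ⟶ Y) [Mono f] : IsSplitMono f := by
  let := hC.abelian
  obtain ⟨m, S, ι, π, hS, h1, h2⟩ := hC.exists_decomposition X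
  have h : ∀ i, ∃ l : Y ⟶ S i, f ≫ l = π i := fun i => by
    have := hS i
    have hne : pushout.inl (π i) f ≠ 0 := fun h0 => by
      exact Simple.not_isZero (S i) (IsZero.of_mono_eq_zero _ h0)
    have := hC.isSplitMono_of_simple (hS i) hne
    exact ⟨pushout.inr (π i) f ≫ retraction (pushout.inl (π i) f), by
      rw [← Category.assoc, ← pushout.condition, Category.assoc, IsSplitMono.id, Category.comp_id]⟩
  choose l hl using h
  refine ⟨⟨∑ i, l i ≫ ι i, ?_⟩⟩
  simp only [Preadditive.comp_sum, ← Category.assoc, hl, h2]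

end IsFusionCategory

end Fusion

/-! ### Duality and tensor products of simple objects -/

section Dual

variable {C : Type u} [Category.{v} C] [MonoidalCategory C]

theorem IsDual.congr_left {X X' Y : C} (h : IsDual X Y) (e : X ≅ X') : IsDual X' Y := by
  obtain ⟨p⟩ := h
  exact ⟨exactPairingCongrLeft e.symm⟩

theorem IsDual.congr_right {X Y Y' : C} (h : IsDual X Y) (e : Y ≅ Y') : IsDual X Y' := by
  obtain ⟨p⟩ := h
  exact ⟨exactPairingCongrRight e.symm⟩

theorem IsDual.iso_right {X Y Y' : C} (h : IsDual X Y) (h' : IsDual X Y') :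
    Nonempty (Y ≅ Y') := by
  obtain ⟨p⟩ := h
  obtain ⟨p'⟩ := h'
  exact ⟨rightDualIso p p'⟩

theorem IsDual.iso_left {X X' Y : C} (h : IsDual X Y) (h' : IsDual X' Y) :
    Nonempty (X ≅ X') := by
  obtain ⟨p⟩ := h
  obtain ⟨p'⟩ := h'
  exact ⟨leftDualIso p p'⟩

/-- A retract of `X` gives a retract of the dual of `X`, by taking mates. -/
theorem IsDual.retract_right {X Y S T : C} (h : IsDual X Y) (h' : IsDual S T) (r : Retract S X) :
    Nonempty (Retract T Y) := by
  obtain ⟨p⟩ := h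
  obtain ⟨p'⟩ := h'
  let : HasRightDual X := ⟨Y⟩
  let : HasRightDual S := ⟨T⟩
  exact ⟨⟨r.rᘁ, r.iᘁ, by rw [← comp_rightAdjointMate, r.retract, rightAdjointMate_id]; rfl⟩⟩

theorem IsDual.retract_left {X Y S T : C} (h : IsDual X Y) (h' : IsDual S T) (r : Retract T Y) :
    Nonempty (Retract S X) := by
  obtain ⟨p⟩ := h
  obtain ⟨p'⟩ := h'
  let : HasLeftDual Y := ⟨X⟩
  let : HasLeftDual T := ⟨S⟩
  exact ⟨⟨ᘁr.r, ᘁr.i, by rw [← comp_leftAdjointMate, r.retract, leftAdjointMate_id]; rfl⟩⟩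

end Dual

section DualPreadditive

variable {C : Type u} [Category.{v} C] [Preadditive C] [MonoidalCategory C]
  [MonoidalPreadditive C]

theorem IsDual.isZero_left {X Y : C} (h : IsDual X Y) (hY : IsZero Y) : IsZero X := by
  obtain ⟨p⟩ := h
  let : HasLeftDual Y := ⟨X⟩
  rw [IsZero.iff_id_eq_zero] at hY ⊢
  have := leftAdjointMate_id (X := Y)
  rw [hY] at this
  exact this.symm.trans (by simp [leftAdjointMate])

theorem IsDual.isZero_right {X Y : C} (h : IsDual X Y) (hX : IsZero X) : IsZero Y := by
  obtain ⟨p⟩ := h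
  let : HasRightDual X := ⟨Y⟩
  rw [IsZero.iff_id_eq_zero] at hX ⊢
  have := rightAdjointMate_id (X := X)
  rw [hX] at this
  exact this.symm.trans (by simp [rightAdjointMate])

end DualPreadditive

section FusionTensor

variable {k : Type w} [Field k] {C : Type u} [Category.{v} C] [Preadditive C] [Linear k C]
  [MonoidalCategory C]

namespace IsFusionCategory

variable (hC : IsFusionCategory k C)

include hC

theorem isConstituent_tensor_mono_left {X W V Z : C} (h : IsConstituent Z (X ⊗ V))
    (hV : IsConstituent V W) : IsConstituent Z (X ⊗ W) := by
  obtain ⟨r⟩ := hC.retract_of_isConstituent hV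
  exact hC.isConstituent_trans_retract h (r.map (tensorLeft X))

theorem isConstituent_tensor_mono_right {X W V Z : C} (h : IsConstituent Z (V ⊗ X))
    (hV : IsConstituent V W) : IsConstituent Z (W ⊗ X) := by
  obtain ⟨r⟩ := hC.retract_of_isConstituent hV
  exact hC.isConstituent_trans_retract h (r.map (tensorRight X))

end IsFusionCategory

end FusionTensor

section FusionDual

variable {k : Type w} [Field k] {C : Type u} [Category.{v} C] [Preadditive C] [Linear k C]
  [MonoidalCategory C] [MonoidalPreadditive C]

namespace IsFusionCategory

variable (hC : IsFusionCategory k C)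

include hC

/-- Frobenius reciprocity: `A` occurs in `X ⊗ B` if and only if `B` occurs in `X^* ⊗ A`. -/
theorem isConstituent_tensor_left_iff {X D A B : C} (h : IsDual X D) (hA : Simple A)
    (hB : Simple B) : IsConstituent A (X ⊗ B) ↔ IsConstituent B (D ⊗ A) := by
  obtain ⟨p⟩ := h
  constructor
  · rintro ⟨-, f, hf⟩
    refine hC.isConstituent_of_hom_to hB (f := (tensorLeftHomEquiv A X D B).symm f) fun h0 => hf ?_
    rw [Equiv.symm_apply_eq] at h0
    simpa [tensorLeftHomEquiv] using h0
  · intro h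
    obtain ⟨r⟩ := hC.retract_of_isConstituent h
    refine ⟨hA, tensorLeftHomEquiv A X D B r.r, fun h0 => id_nonzero B ?_⟩
    rw [← Equiv.eq_symm_apply] at h0
    have hr : r.r = 0 := by simpa [tensorLeftHomEquiv] using h0
    rw [← r.retract, hr, comp_zero]

/-- Frobenius reciprocity: `B` occurs in `A ⊗ X` if and only if `A` occurs in `B ⊗ X^*`. -/
theorem isConstituent_tensor_right_iff {X D A B : C} (h : IsDual X D) (hA : Simple A)
    (hB : Simple B) : IsConstituent B (A ⊗ X) ↔ IsConstituent A (B ⊗ D) := by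
  obtain ⟨p⟩ := h
  constructor
  · intro h
    obtain ⟨r⟩ := hC.retract_of_isConstituent h
    refine ⟨hA, tensorRightHomEquiv A X D B r.r, fun h0 => id_nonzero B ?_⟩
    rw [← Equiv.eq_symm_apply] at h0
    have hr : r.r = 0 := by simpa [tensorRightHomEquiv] using h0
    rw [← r.retract, hr, comp_zero]
  · rintro ⟨-, f, hf⟩
    refine hC.isConstituent_of_hom_to hB (f := (tensorRightHomEquiv A X D B).symm f) fun h0 => hf ?_
    rw [Equiv.symm_apply_eq] at h0
    simpa [tensorRightHomEquiv] using h0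

theorem simple_dual {X D : C} (h : IsDual X D) (hX : Simple X) : Simple D := by
  obtain ⟨S, hS⟩ := hC.exists_isConstituent (W := D) fun h0 =>
    Simple.not_isZero X (h.isZero_left h0)
  obtain ⟨r⟩ := hC.retract_of_isConstituent hS
  obtain ⟨E, hE⟩ := (hC.rigid S).2
  obtain ⟨r'⟩ := h.retract_left hE r
  have hi : r'.i ≠ 0 := fun h0 => by
    have := hS.1
    refine Simple.not_isZero S (hE.isZero_right ((IsZero.iff_id_eq_zero E).2 ?_))
    rw [← r'.retract, h0, zero_comp]
  have : Mono r'.i := inferInstance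
  have : IsIso r'.i := isIso_of_mono_of_nonzero hi
  obtain ⟨e⟩ := (hE.congr_left (asIso r'.i)).iso_right h
  exact (Simple.iff_of_iso e).1 hS.1

theorem isConstituent_unit_left {X D : C} (h : IsDual X D) (hX : Simple X) :
    IsConstituent (𝟙_ C) (X ⊗ D) := by
  obtain ⟨p⟩ := h
  refine ⟨hC.unitSimple, η_ X D, fun h0 => id_nonzero X ?_⟩
  have := ExactPairing.evaluation_coevaluation X D
  rw [h0] at this
  have h1 : (λ_ X).hom ≫ (ρ_ X).inv = 0 := by rw [← this]; simp
  rw [← cancel_epi (λ_ X).hom, ← cancel_mono (ρ_ X).inv]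
  simpa using h1

/-- For simple objects, left and right duals agree. -/
theorem isDual_symm {X D : C} (h : IsDual X D) (hX : Simple X) : IsDual D X := by
  obtain ⟨E, hE⟩ := (hC.rigid X).2
  have hD := hC.simple_dual h hX
  have hDE := (hC.isConstituent_tensor_left_iff hE hD hC.unitSimple).2
    (hC.isConstituent_unit_left h hX)
  have hDE' := hC.isConstituent_congr hDE (ρ_ E)
  obtain ⟨r⟩ := hC.retract_of_isConstituent hDE'
  obtain ⟨E', hE'⟩ := (hC.rigid D).1
  obtain ⟨r'⟩ := hE.retract_right hE' r
  have hE'X : IsConstituent E' X := .of_retract (hC.simple_dual hE' hD) r'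
  obtain ⟨e⟩ := hC.iso_of_isConstituent hE'X hX
  exact hE'.congr_right e

theorem simple_dual_iff {X D : C} (h : IsDual X D) : Simple X ↔ Simple D := by
  refine ⟨hC.simple_dual h, fun hD => ?_⟩
  obtain ⟨E, hE⟩ := (hC.rigid D).1
  have hE' := hC.isDual_symm hE hD
  obtain ⟨e⟩ := hE'.iso_left h
  exact (Simple.iff_of_iso e).1 (hC.simple_dual hE hD)

theorem isConstituent_unit_right {X D : C} (h : IsDual X D) (hX : Simple X) :
    IsConstituent (𝟙_ C) (D ⊗ X) :=
  hC.isConstituent_unit_left (hC.isDual_symm h hX) (hC.simple_dual h hX)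

theorem exists_isConstituent_tensor_left {X W Z : C} (h : IsConstituent Z (X ⊗ W)) :
    ∃ V, IsConstituent V W ∧ IsConstituent Z (X ⊗ V) := by
  obtain ⟨hZ, f, hf⟩ := h
  let F : (W ⟶ W) →+ (Z ⟶ X ⊗ W) :=
    { toFun := fun g => f ≫ X ◁ g
      map_zero' := by simp
      map_add' := fun a b => by simp }
  obtain ⟨S, r, hS, h⟩ := hC.exists_retract_of_ne_zero F (by simpa [F] using hf)
  refine ⟨S, .of_retract hS r, hZ, f ≫ X ◁ r.r, fun h0 => h ?_⟩
  simp [F, reassoc_of% h0]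

theorem exists_isConstituent_tensor_right {X W Z : C} (h : IsConstituent Z (W ⊗ X)) :
    ∃ V, IsConstituent V W ∧ IsConstituent Z (V ⊗ X) := by
  obtain ⟨hZ, f, hf⟩ := h
  let F : (W ⟶ W) →+ (Z ⟶ W ⊗ X) :=
    { toFun := fun g => f ≫ g ▷ X
      map_zero' := by simp
      map_add' := fun a b => by simp }
  obtain ⟨S, r, hS, h⟩ := hC.exists_retract_of_ne_zero F (by simpa [F] using hf)
  refine ⟨S, .of_retract hS r, hZ, f ≫ r.r ▷ X, fun h0 => h ?_⟩
  simp [F, reassoc_of% h0]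

theorem exists_isConstituent_tensor {X Y : C} (hX : Simple X) (hY : Simple Y) :
    ∃ Z, IsConstituent Z (X ⊗ Y) := by
  obtain ⟨D, hD⟩ := (hC.rigid X).1
  obtain ⟨r⟩ := hC.retract_of_isConstituent (hC.isConstituent_unit_right hD hX)
  have r' := (Retract.ofIso (λ_ Y).symm).trans
    ((r.map (tensorRight Y)).trans (.ofIso (α_ D X Y)))
  obtain ⟨Z, hZ, -⟩ := hC.exists_isConstituent_tensor_left (IsConstituent.of_retract hY r')
  exact ⟨Z, hZ⟩

/-- Tensoring with `M ≠ 0` reflects simplicity, because it is a faithful exact functor. -/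
theorem simple_of_simple_tensor_left {M W : C} (hM : ¬ IsZero M) (h : Simple (M ⊗ W)) :
    Simple W := by
  let := hC.abelian
  obtain ⟨S, hS⟩ := hC.exists_isConstituent hM
  obtain ⟨D, hD⟩ := (hC.rigid S).1
  obtain ⟨r⟩ := hC.retract_of_isConstituent
    (hC.isConstituent_tensor_mono_left (hC.isConstituent_unit_right hD hS.1) hS)
  obtain ⟨E, ⟨p⟩⟩ := (hC.rigid M).1
  have : (tensorLeft M).PreservesMonomorphisms :=
    (tensorLeft M).preservesMonomorphisms_of_adjunction (tensorLeftAdjunction M E)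
  have : (tensorLeft M).Faithful := by
    refine ⟨fun {A B f g} hfg => ?_⟩
    have h1 : (D ⊗ M) ◁ f = (D ⊗ M) ◁ g := by
      have hfg : M ◁ f = M ◁ g := hfg
      simp [hfg]
    have h2 : 𝟙_ C ◁ f = 𝟙_ C ◁ g := by
      have : r.i ▷ A ≫ (D ⊗ M) ◁ f ≫ r.r ▷ B = r.i ▷ A ≫ (D ⊗ M) ◁ g ≫ r.r ▷ B := by rw [h1]
      simpa only [whisker_exchange, ← comp_whiskerRight_assoc, r.retract, id_whiskerRight,
        Category.id_comp] using this
    simpa using h2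
  have : Simple ((tensorLeft M).obj W) := h
  exact (tensorLeft M).simple_of_simple_obj W

theorem simple_of_simple_tensor_right {M W : C} (hM : Simple M) (h : Simple (W ⊗ M)) :
    Simple W := by
  let := hC.abelian
  obtain ⟨D, hD⟩ := (hC.rigid M).2
  have hD' := (hC.simple_dual_iff hD).2 hM
  obtain ⟨r⟩ := hC.retract_of_isConstituent (hC.isConstituent_unit_right hD hD')
  obtain ⟨p⟩ := hD
  have : (tensorRight M).PreservesMonomorphisms :=
    (tensorRight M).preservesMonomorphisms_of_adjunction (tensorRightAdjunction D M)
  have : (tensorRight M).Faithful := by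
    refine ⟨fun {A B f g} hfg => ?_⟩
    have h1 : f ▷ (M ⊗ D) = g ▷ (M ⊗ D) := by
      have hfg : f ▷ M = g ▷ M := hfg
      simp [hfg]
    have h2 : f ▷ 𝟙_ C = g ▷ 𝟙_ C := by
      have : A ◁ r.i ≫ f ▷ (M ⊗ D) ≫ B ◁ r.r = A ◁ r.i ≫ g ▷ (M ⊗ D) ≫ B ◁ r.r := by rw [h1]
      simpa only [← whisker_exchange, ← whiskerLeft_comp_assoc, r.retract, whiskerLeft_id,
        Category.id_comp] using this
    simpa using h2
  have : Simple ((tensorRight M).obj W) := h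
  exact (tensorRight M).simple_of_simple_obj W

/-! ### Invertible objects -/

theorem isDual_of_tensor_iso_unit {X Y : C} (hX : Simple X) (e : X ⊗ Y ≅ 𝟙_ C) :
    IsDual X Y := by
  obtain ⟨D, hD⟩ := (hC.rigid X).1
  have hXY := (Simple.iff_of_iso e).2 hC.unitSimple
  have hY := hC.simple_of_simple_tensor_left (Simple.not_isZero X) hXY
  have h1 : IsConstituent (𝟙_ C) (X ⊗ Y) := .of_retract hC.unitSimple (.ofIso e.symm)
  have h2 := (hC.isConstituent_tensor_left_iff hD hC.unitSimple hY).1 h1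
  obtain ⟨i⟩ := hC.iso_of_isConstituent (hC.isConstituent_congr h2 (ρ_ D)) (hC.simple_dual hD hX)
  exact hD.congr_right i.symm

theorem isInvertible_iff {X : C} (hX : Simple X) :
    IsInvertible X ↔ ∃ Y, Nonempty (X ⊗ Y ≅ 𝟙_ C) :=
  ⟨fun ⟨Y, _, h⟩ => ⟨Y, h⟩, fun ⟨Y, ⟨e⟩⟩ => ⟨Y, hC.isDual_of_tensor_iso_unit hX e, ⟨e⟩⟩⟩

theorem tensor_iso_unit_symm {X Y : C} (hX : Simple X) (e : X ⊗ Y ≅ 𝟙_ C) :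
    Nonempty (Y ⊗ X ≅ 𝟙_ C) := by
  have hYX : Simple (Y ⊗ X) := hC.simple_of_simple_tensor_left (Simple.not_isZero X)
    ((Simple.iff_of_iso ((α_ X Y X).symm ≪≫ whiskerRightIso e X ≪≫ λ_ X)).2 hX)
  obtain ⟨j⟩ := hC.iso_of_isConstituent
    (hC.isConstituent_unit_right (hC.isDual_of_tensor_iso_unit hX e) hX) hYX
  exact ⟨j.symm⟩

theorem simple_of_tensor_iso_unit {L M : C} (e : M ⊗ L ≅ 𝟙_ C) : Simple L := by
  have h : Simple (M ⊗ L) := (Simple.iff_of_iso e).2 hC.unitSimple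
  exact hC.simple_of_simple_tensor_left (fun h0 => Simple.not_isZero (M ⊗ L)
    ((tensorRight L).map_isZero h0)) h

theorem isNonInvSimple_tensor_left {L M X : C} (e : L ⊗ M ≅ 𝟙_ C) (e' : M ⊗ L ≅ 𝟙_ C)
    (hX : IsNonInvSimple X) : IsNonInvSimple (L ⊗ X) := by
  have hM := hC.simple_of_tensor_iso_unit e
  have hLX : Simple (L ⊗ X) := hC.simple_of_simple_tensor_left (Simple.not_isZero M)
    ((Simple.iff_of_iso ((α_ M L X).symm ≪≫ whiskerRightIso e' X ≪≫ λ_ X)).2 hX.1)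
  refine ⟨hLX, fun h => hX.2 ?_⟩
  obtain ⟨Y, ⟨i⟩⟩ := (hC.isInvertible_iff hLX).1 h
  have j : X ⊗ Y ≅ M := (λ_ _).symm ≪≫ whiskerRightIso e'.symm _ ≪≫ α_ M L (X ⊗ Y) ≪≫
    whiskerLeftIso M ((α_ L X Y).symm ≪≫ i) ≪≫ ρ_ M
  exact (hC.isInvertible_iff hX.1).2 ⟨Y ⊗ L, ⟨(α_ X Y L).symm ≪≫ whiskerRightIso j L ≪≫ e'⟩⟩

theorem isNonInvSimple_tensor_right {L M X : C} (e : L ⊗ M ≅ 𝟙_ C)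
    (hX : IsNonInvSimple X) : IsNonInvSimple (X ⊗ L) := by
  have hM := hC.simple_of_tensor_iso_unit e
  have hXL : Simple (X ⊗ L) := hC.simple_of_simple_tensor_right hM
    ((Simple.iff_of_iso (α_ X L M ≪≫ whiskerLeftIso X e ≪≫ ρ_ X)).2 hX.1)
  refine ⟨hXL, fun h => hX.2 ?_⟩
  obtain ⟨Y, ⟨i⟩⟩ := (hC.isInvertible_iff hXL).1 h
  exact (hC.isInvertible_iff hX.1).2 ⟨L ⊗ Y, ⟨(α_ X L Y).symm ≪≫ i⟩⟩

theorem isNonInvSimple_dual {X D : C} (h : IsDual X D) (hX : IsNonInvSimple X) :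
    IsNonInvSimple D := by
  have hD := hC.simple_dual h hX.1
  refine ⟨hD, fun ⟨D', hD', ⟨i⟩⟩ => hX.2 ?_⟩
  obtain ⟨e⟩ := (hC.isDual_symm h hX.1).iso_right hD'
  exact ⟨D, h, hC.tensor_iso_unit_symm hD (whiskerLeftIso D e ≪≫ i)⟩

end IsFusionCategory

end FusionDual

/-! ### The universal grading -/

section UniversalDegree

variable {C : Type u} [Category.{v} C] [Preadditive C] [MonoidalCategory C]

theorem universalDegree_mul {X Y Z : C} (hX : Simple X) (hY : Simple Y)
    (h : IsConstituent Z (X ⊗ Y)) :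
    universalDegree X hX * universalDegree Y hY = universalDegree Z h.1 := by
  have := PresentedGroup.one_of_mem (rels := {r : FreeGroup {X : C // Simple X} |
    ∃ X Y Z : {X : C // Simple X}, IsConstituent Z.1 (X.1 ⊗ Y.1) ∧
      r = FreeGroup.of X * FreeGroup.of Y * (FreeGroup.of Z)⁻¹})
    (show _ ∈ _ from ⟨⟨X, hX⟩, ⟨Y, hY⟩, ⟨Z, h.1⟩, h, rfl⟩)
  rw [map_mul, map_mul, map_inv, mul_inv_eq_one] at this
  exact this

theorem adjointProp_tensor_dual {X D Z : C} (hX : Simple X) (h : IsDual X D)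
    (hZ : IsConstituent Z (X ⊗ D)) : adjointProp C Z :=
  fun _ _ hP => hP X D Z hX h hZ

theorem IsFusionSubcategory.congr {P : ObjectProperty C} (hP : IsFusionSubcategory P) {X Y : C}
    (e : X ≅ Y) (hX : P X) : P Y :=
  hP.retract Y X ⟨.ofIso e.symm⟩ hX

/-- `X` occurs in `A ⊗ Y` for some object `A` of the adjoint subcategory. On simple objects this is
the equivalence relation of lying in the same component of the universal grading. -/
def AdjointRel (X Y : C) : Prop :=
  ∃ A, adjointProp C A ∧ IsConstituent X (A ⊗ Y)

theorem AdjointRel.refl {X : C} (hX : Simple X) : AdjointRel X X :=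
  ⟨𝟙_ C, adjointProp_isFusionSubcategory.unit, .of_retract hX (.ofIso (λ_ X).symm)⟩

end UniversalDegree

section FusionGrading

variable {k : Type w} [Field k] {C : Type u} [Category.{v} C] [Preadditive C] [Linear k C]
  [MonoidalCategory C]

namespace IsFusionCategory

variable (hC : IsFusionCategory k C)

include hC

theorem isFusionSubcategory_of_constituents {P : ObjectProperty C} (hP : IsFusionSubcategory P)
    {X : C} (h : ∀ Z, IsConstituent Z X → P Z) : P X :=
  hP.directSum X (hC.isDirectSumOf_of_isConstituent h)

theorem prop_of_isConstituent {P : ObjectProperty C} (hP : IsFusionSubcategory P) {X Z : C}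
    (hX : P X) (h : IsConstituent Z X) : P Z :=
  hP.retract Z X (hC.retract_of_isConstituent h) hX

theorem universalDegree_unit : universalDegree (𝟙_ C) hC.unitSimple = 1 := by
  have h := universalDegree_mul hC.unitSimple hC.unitSimple
    (hC.isConstituent_congr (Simple.isConstituent_self hC.unitSimple) (λ_ (𝟙_ C)).symm)
  exact mul_eq_left.1 h

theorem universalDegree_congr {X Y : C} (hX : Simple X) (hY : Simple Y) (e : X ≅ Y) :
    universalDegree X hX = universalDegree Y hY := by
  have h := universalDegree_mul hC.unitSimple hX (.of_retract hY (.ofIso (e.symm ≪≫ (λ_ X).symm)))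
  rwa [hC.universalDegree_unit, one_mul] at h

theorem universalGrading_of_simple {X : C} (hX : Simple X) :
    universalGrading C (universalDegree X hX) X := by
  intro Z hZ hZX
  obtain ⟨e⟩ := hC.iso_of_isConstituent hZX hX
  exact hC.universalDegree_congr _ _ e

theorem adjointRel_trans {X Y Z : C} (h : AdjointRel X Y) (h' : AdjointRel Y Z) :
    AdjointRel X Z := by
  obtain ⟨A, hA, h⟩ := h
  obtain ⟨B, hB, h'⟩ := h'
  exact ⟨A ⊗ B, adjointProp_isFusionSubcategory.tensor _ _ hA hB,
    hC.isConstituent_congr (hC.isConstituent_tensor_mono_left h h') (α_ A B Z).symm⟩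

end IsFusionCategory

end FusionGrading

section FusionGrading

variable {k : Type w} [Field k] {C : Type u} [Category.{v} C] [Preadditive C] [Linear k C]
  [MonoidalCategory C] [MonoidalPreadditive C]

namespace IsFusionCategory

variable (hC : IsFusionCategory k C)

include hC

theorem universalDegree_dual {X D : C} (h : IsDual X D) (hX : Simple X) (hD : Simple D) :
    universalDegree D hD = (universalDegree X hX)⁻¹ := by
  rw [eq_inv_iff_mul_eq_one, universalDegree_mul hD hX (hC.isConstituent_unit_right h hX),
    hC.universalDegree_unit]

/-- Every element of the universal grading group is the class of a simple object: such classes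
are closed under products because a product of simple objects is nonzero, and under inverses by
duality. -/
theorem exists_universalDegree_eq (u : UniversalGradingGroup C) :
    ∃ (X : C) (hX : Simple X), universalDegree X hX = u := by
  let H : Subgroup (UniversalGradingGroup C) :=
    { carrier := {u | ∃ (X : C) (hX : Simple X), universalDegree X hX = u}
      mul_mem' := by
        rintro _ _ ⟨X, hX, rfl⟩ ⟨Y, hY, rfl⟩
        obtain ⟨Z, hZ⟩ := hC.exists_isConstituent_tensor hX hY
        exact ⟨Z, hZ.1, (universalDegree_mul hX hY hZ).symm⟩
      one_mem' := ⟨_, _, hC.universalDegree_unit⟩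
      inv_mem' := by
        rintro _ ⟨X, hX, rfl⟩
        obtain ⟨D, hD⟩ := (hC.rigid X).1
        exact ⟨D, _, hC.universalDegree_dual hD hX (hC.simple_dual hD hX)⟩ }
  have hH : (⊤ : Subgroup (UniversalGradingGroup C)) ≤ H := by
    rw [← PresentedGroup.closure_range_of, Subgroup.closure_le]
    rintro _ ⟨⟨X, hX⟩, rfl⟩
    exact ⟨X, hX, rfl⟩
  exact hH (Subgroup.mem_top u)

theorem finite_universalGradingGroup : Finite (UniversalGradingGroup C) := by
  obtain ⟨m, S, hS⟩ := hC.finiteSimples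
  choose X hX hu using hC.exists_universalDegree_eq
  choose i hi using fun u => hS (X u) (hX u)
  refine Finite.of_injective i fun a b hab => ?_
  obtain ⟨ea⟩ := hi a
  obtain ⟨eb⟩ := hi b
  rw [← hu a, ← hu b]
  exact hC.universalDegree_congr _ _ (ea ≪≫ eqToIso (congrArg S hab) ≪≫ eb.symm)

theorem universalGrading_tensor {g h : UniversalGradingGroup C} {X Y : C}
    (hX : universalGrading C g X) (hY : universalGrading C h Y) :
    universalGrading C (g * h) (X ⊗ Y) := by
  intro Z hZ hZXY
  obtain ⟨V, hV, hZV⟩ := hC.exists_isConstituent_tensor_right hZXY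
  obtain ⟨W, hW, hZW⟩ := hC.exists_isConstituent_tensor_left hZV
  rw [← universalDegree_mul hV.1 hW.1 hZW, hX V _ hV, hY W _ hW]

theorem universalGrading_dual {g : UniversalGradingGroup C} {X Y : C} (h : IsDual X Y) :
    universalGrading C g X ↔ universalGrading C g⁻¹ Y := by
  constructor
  · intro hX S hS hSY
    obtain ⟨E, hE⟩ := (hC.rigid S).2
    obtain ⟨r⟩ := hC.retract_of_isConstituent hSY
    obtain ⟨r'⟩ := h.retract_left hE r
    have hES := (hC.simple_dual_iff hE).2 hS
    rw [hC.universalDegree_dual hE hES, hX E hES (.of_retract hES r')]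
  · intro hY S hS hSX
    obtain ⟨E, hE⟩ := (hC.rigid S).1
    obtain ⟨r⟩ := hC.retract_of_isConstituent hSX
    obtain ⟨r'⟩ := h.retract_right hE r
    have hES := hC.simple_dual hE hS
    have := hY E hES (.of_retract hES r')
    rwa [hC.universalDegree_dual hE hS, inv_inj] at this

theorem isGrading_universalGrading : IsGrading (universalGrading C) where
  finite := hC.finite_universalGradingGroup
  iso := fun g X Y ⟨e⟩ hX Z hZ hZY => hX Z hZ (hC.isConstituent_congr hZY e.symm)
  orthogonal := by
    intro g h X Y hgh hX hY f
    by_contra hf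
    obtain ⟨S, r, hS, hr⟩ := hC.exists_retract_of_ne_zero (Preadditive.rightComp X f)
      (by simpa [Preadditive.rightComp] using hf)
    refine hgh ((hX S hS (.of_retract hS r)).symm.trans (hY S hS ⟨hS, r.i ≫ f, fun h0 => hr ?_⟩))
    simp [Preadditive.rightComp, h0]
  decomposition := by
    intro X
    have := hC.hasFiniteProducts
    have : HasFiniteBiproducts C := .of_hasFiniteProducts
    have := hC.finite_universalGradingGroup
    obtain ⟨m, S, b, ⟨hb⟩, hS, ⟨e⟩⟩ := hC.semisimple X
    let d : Fin m → UniversalGradingGroup C := fun i => universalDegree (S i) (hS i)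
    let T : ∀ u, {i // d i = u} → C := fun u i => S i
    refine ⟨fun u => ⨁ T u, biproduct.bicone _, ⟨biproduct.isBilimit _⟩, fun u Z hZ hZT => ?_,
      ⟨biproductBiproductIso _ T ≪≫ biproduct.whiskerEquiv (Equiv.sigmaFiberEquiv d)
        (fun _ => Iso.refl _) ≪≫ (biproduct.uniqueUpToIso S hb).symm ≪≫ e⟩⟩
    obtain ⟨-, f, hf⟩ := hZT
    obtain ⟨i, hi⟩ : ∃ i, f ≫ biproduct.π (T u) i ≠ 0 := by
      by_contra! h
      exact hf (biproduct.hom_ext _ _ fun i => by rw [h i, zero_comp])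
    have := hC.isIso_of_ne_zero hZ (hS i) hi
    exact (hC.universalDegree_congr hZ (hS i) (asIso (f ≫ biproduct.π (T u) i))).trans i.2
  tensor := fun _ _ _ _ => hC.universalGrading_tensor
  dual := fun _ _ _ => hC.universalGrading_dual

theorem isFaithfulGrading_universalGrading : IsFaithfulGrading (universalGrading C) := by
  intro u
  obtain ⟨X, hX, rfl⟩ := hC.exists_universalDegree_eq u
  exact ⟨X, hC.universalGrading_of_simple hX, Simple.not_isZero X⟩

theorem isFusionSubcategory_universalGrading_one :
    IsFusionSubcategory (universalGrading C 1) where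
  unit := by
    have := hC.universalGrading_of_simple hC.unitSimple
    rwa [hC.universalDegree_unit] at this
  tensor := fun X Y hX hY => by simpa using hC.universalGrading_tensor hX hY
  retract := fun X Y ⟨r⟩ hY Z hZ hZX => hY Z hZ (hC.isConstituent_trans_retract hZX r)
  directSum := fun X hX Z hZ hZX => by
    obtain ⟨Y, hY, hZY⟩ := hZX.exists_of_isDirectSumOf hX
    exact hY Z hZ hZY
  dual := fun X Y h => by simpa using hC.universalGrading_dual (g := 1) h

theorem universalGrading_one_of_adjointProp {X : C} (hX : adjointProp C X) :
    universalGrading C 1 X := by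
  refine hX _ hC.isFusionSubcategory_universalGrading_one fun Y D Z hY hD hZ => ?_
  have := hC.universalGrading_of_simple hZ.1
  rwa [← universalDegree_mul hY (hC.simple_dual hD hY) hZ, hC.universalDegree_dual hD hY,
    mul_inv_cancel] at this

/-- The adjoint subcategory is normal: `X ⊗ C_ad ⊆ C_ad ⊗ X` for every simple `X`. For a generator
`Z` occurring in `Y ⊗ Y^*`, a constituent of `X ⊗ Z` occurs in `V ⊗ Y^*` for some `V` occurring in
`X ⊗ Y`, and then `Y^*` occurs in `V^* ⊗ X`. -/
theorem exists_adjointProp_tensor {A X W : C} (hA : adjointProp C A) (hX : Simple X)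
    (hW : IsConstituent W (X ⊗ A)) :
    ∃ B, adjointProp C B ∧ IsConstituent W (B ⊗ X) := by
  have had := adjointProp_isFusionSubcategory (C := C)
  suffices h : ∀ X W, Simple X → IsConstituent W (X ⊗ A) →
      ∃ B, adjointProp C B ∧ IsConstituent W (B ⊗ X) from h X W hX hW
  clear! X W
  refine hA (fun A => ∀ X W, Simple X → IsConstituent W (X ⊗ A) →
      ∃ B, adjointProp C B ∧ IsConstituent W (B ⊗ X)) ⟨?_, ?_, ?_, ?_, ?_⟩ ?_
  · intro X W hX hW
    exact ⟨𝟙_ C, had.unit, hC.isConstituent_congr hW (ρ_ X ≪≫ (λ_ X).symm)⟩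
  · intro Y Y' hY hY' X W hX hW
    obtain ⟨V, hV, hWV⟩ := hC.exists_isConstituent_tensor_right
      (hC.isConstituent_congr hW (α_ X Y Y').symm)
    obtain ⟨B, hB, hVB⟩ := hY X V hX hV
    obtain ⟨B', hB', hWB⟩ := hY' V W hV.1 hWV
    exact ⟨B' ⊗ B, had.tensor _ _ hB' hB, hC.isConstituent_congr
      (hC.isConstituent_tensor_mono_left hWB hVB) (α_ B' B X).symm⟩
  · rintro Y Y' ⟨r⟩ hY' X W hX hW
    exact hY' X W hX (hC.isConstituent_trans_retract hW (r.map (tensorLeft X)))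
  · intro Y hY X W hX hW
    obtain ⟨V, hV, hWV⟩ := hC.exists_isConstituent_tensor_left hW
    obtain ⟨S, hS, hVS⟩ := hV.exists_of_isDirectSumOf hY
    exact hS X W hX (hC.isConstituent_tensor_mono_left hWV hVS)
  · intro Y D hYD
    have key : ∀ X W, Simple X → Simple W →
        (∃ B, adjointProp C B ∧ IsConstituent W (B ⊗ X)) →
        ∃ B, adjointProp C B ∧ IsConstituent X (B ⊗ W) := by
      rintro X W hX hW ⟨B, hB, hWB⟩
      obtain ⟨E, hE⟩ := (hC.rigid B).1
      exact ⟨E, (had.dual _ _ hE).1 hB, (hC.isConstituent_tensor_left_iff hE hW hX).1 hWB⟩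
    constructor
    · intro hY X W hX hW
      exact key W X hW.1 hX (hY W X hW.1
        ((hC.isConstituent_tensor_right_iff hYD hW.1 hX).2 hW))
    · intro hD X W hX hW
      exact key W X hW.1 hX (hD W X hW.1
        ((hC.isConstituent_tensor_right_iff hYD hX hW.1).1 hW))
  · intro Y D Z hY hYD hZ X W hX hW
    have hD := hC.simple_dual hYD hY
    obtain ⟨V, hV, hWV⟩ := hC.exists_isConstituent_tensor_right
      (hC.isConstituent_congr (hC.isConstituent_tensor_mono_left hW hZ) (α_ X Y D).symm)
    obtain ⟨E, hE⟩ := (hC.rigid V).1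
    have h1 := (hC.isConstituent_tensor_right_iff hYD hX hV.1).1 hV
    have h2 := (hC.isConstituent_tensor_left_iff hE hX hD).1 h1
    refine ⟨V ⊗ E, hC.isFusionSubcategory_of_constituents had
      fun T hT => adjointProp_tensor_dual hV.1 hE hT, ?_⟩
    exact hC.isConstituent_congr (hC.isConstituent_tensor_mono_left hWV h2) (α_ V E X).symm

theorem adjointRel_symm {X Y : C} (hY : Simple Y) (h : AdjointRel X Y) : AdjointRel Y X := by
  obtain ⟨A, hA, h⟩ := h
  obtain ⟨D, hD⟩ := (hC.rigid A).1
  exact ⟨D, (adjointProp_isFusionSubcategory.dual _ _ hD).1 hA,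
    (hC.isConstituent_tensor_left_iff hD h.1 hY).1 h⟩

/-- Any two constituents of a product of simple objects are related. -/
theorem adjointRel_of_isConstituent {X Y Z Z' : C} (hX : Simple X) (hY : Simple Y)
    (h : IsConstituent Z (X ⊗ Y)) (h' : IsConstituent Z' (X ⊗ Y)) : AdjointRel Z Z' := by
  obtain ⟨D, hD⟩ := (hC.rigid X).1
  have h1 := (hC.isConstituent_tensor_left_iff hD h'.1 hY).1 h'
  exact ⟨X ⊗ D, hC.isFusionSubcategory_of_constituents adjointProp_isFusionSubcategory
    fun T hT => adjointProp_tensor_dual hX hD hT,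
    hC.isConstituent_congr (hC.isConstituent_tensor_mono_left h h1) (α_ X D Z').symm⟩

theorem adjointRel_tensor {X X' Y Y' Z Z' : C} (hX' : Simple X') (hY' : Simple Y')
    (hX : AdjointRel X X') (hY : AdjointRel Y Y')
    (hZ : IsConstituent Z (X ⊗ Y)) (hZ' : IsConstituent Z' (X' ⊗ Y')) : AdjointRel Z Z' := by
  obtain ⟨A, hA, hXA⟩ := hX
  obtain ⟨B, hB, hYB⟩ := hY
  obtain ⟨V, hV, hZV⟩ := hC.exists_isConstituent_tensor_right
    (hC.isConstituent_congr (hC.isConstituent_tensor_mono_left hZ hYB) (α_ X B Y').symm)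
  obtain ⟨B', hB', hVB⟩ := hC.exists_adjointProp_tensor hB hXA.1 hV
  have hV' := hC.isConstituent_congr (hC.isConstituent_tensor_mono_left hVB hXA)
    (α_ B' A X').symm
  obtain ⟨T, hT, hZT⟩ := hC.exists_isConstituent_tensor_left
    (hC.isConstituent_congr (hC.isConstituent_tensor_mono_right hZV hV') (α_ (B' ⊗ A) X' Y'))
  exact hC.adjointRel_trans ⟨B' ⊗ A, adjointProp_isFusionSubcategory.tensor _ _ hB' hA, hZT⟩
    (hC.adjointRel_of_isConstituent hX' hY' hT hZ')

/-- `AdjointRel` as a setoid on the simple objects. -/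
@[reducible]
def adjointSetoid : Setoid {X : C // Simple X} where
  r X Y := AdjointRel X.1 Y.1
  iseqv :=
    { refl := fun X => AdjointRel.refl X.2
      symm := fun {_ Y} h => hC.adjointRel_symm Y.2 h
      trans := fun h h' => hC.adjointRel_trans h h' }

/-- The product of classes of simple objects: the class of any constituent of the tensor product. -/
noncomputable def adjointMul :
    Quotient hC.adjointSetoid → Quotient hC.adjointSetoid → Quotient hC.adjointSetoid :=
  Quotient.map₂
    (fun X Y => ⟨_, (hC.exists_isConstituent_tensor X.2 Y.2).choose_spec.1⟩)
    (fun X X' hX Y Y' hY => hC.adjointRel_tensor X'.2 Y'.2 hX hY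
      (hC.exists_isConstituent_tensor X.2 Y.2).choose_spec
      (hC.exists_isConstituent_tensor X'.2 Y'.2).choose_spec)

theorem adjointMul_eq {X Y Z : C} (hX : Simple X) (hY : Simple Y)
    (hZ : IsConstituent Z (X ⊗ Y)) :
    hC.adjointMul (Quotient.mk _ ⟨X, hX⟩) (Quotient.mk _ ⟨Y, hY⟩) = Quotient.mk _ ⟨Z, hZ.1⟩ :=
  Quotient.sound (hC.adjointRel_of_isConstituent hX hY
    (hC.exists_isConstituent_tensor hX hY).choose_spec hZ)

/-- The group of classes of simple objects modulo the adjoint subcategory. -/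
@[reducible]
noncomputable def adjointGroup : Group (Quotient hC.adjointSetoid) :=
  letI : Mul (Quotient hC.adjointSetoid) := ⟨hC.adjointMul⟩
  letI : One (Quotient hC.adjointSetoid) := ⟨Quotient.mk _ ⟨𝟙_ C, hC.unitSimple⟩⟩
  letI : Inv (Quotient hC.adjointSetoid) := ⟨fun q => Quotient.mk _
    ⟨(hC.rigid q.out.1).1.choose, hC.simple_dual (hC.rigid q.out.1).1.choose_spec q.out.2⟩⟩
  Group.ofLeftAxioms
    (by
      rintro ⟨X, hX⟩ ⟨Y, hY⟩ ⟨Z, hZ⟩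
      obtain ⟨V, hV⟩ := hC.exists_isConstituent_tensor hX hY
      obtain ⟨W, hW⟩ := hC.exists_isConstituent_tensor hV.1 hZ
      obtain ⟨T, hT, hWT⟩ := hC.exists_isConstituent_tensor_left
        (hC.isConstituent_congr (hC.isConstituent_tensor_mono_right hW hV) (α_ X Y Z))
      change hC.adjointMul (hC.adjointMul (Quotient.mk _ _) (Quotient.mk _ _)) (Quotient.mk _ _) =
        hC.adjointMul (Quotient.mk _ _) (hC.adjointMul (Quotient.mk _ _) (Quotient.mk _ _))
      rw [hC.adjointMul_eq hX hY hV, hC.adjointMul_eq hV.1 hZ hW, hC.adjointMul_eq hY hZ hT,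
        hC.adjointMul_eq hX hT.1 hWT])
    (by
      rintro ⟨X, hX⟩
      exact hC.adjointMul_eq hC.unitSimple hX (.of_retract hX (.ofIso (λ_ X).symm)))
    (by
      intro q
      have h := (hC.rigid q.out.1).1.choose_spec
      have := hC.adjointMul_eq (hC.simple_dual h q.out.2) q.out.2
        (hC.isConstituent_unit_right h q.out.2)
      have hq : (Quotient.mk _ ⟨q.out.1, q.out.2⟩ : Quotient hC.adjointSetoid) = q :=
        Quotient.out_eq q
      rw [hq] at this
      exact this)

/-- The trivial component of the universal grading is the adjoint subcategory: the class of a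
simple object modulo the adjoint subcategory factors through its universal degree. -/
theorem universalGrading_one : universalGrading C 1 = adjointProp C := by
  refine le_antisymm (fun X hX => ?_) fun X hX => hC.universalGrading_one_of_adjointProp hX
  have had := adjointProp_isFusionSubcategory (C := C)
  refine hC.isFusionSubcategory_of_constituents had fun Z hZ => ?_
  have hdeg := hX Z hZ.1 hZ
  let := hC.adjointGroup
  let φ : UniversalGradingGroup C →* Quotient hC.adjointSetoid :=
    PresentedGroup.toGroup (f := fun X => Quotient.mk _ X) (by
      rintro _ ⟨X, Y, Z, h, rfl⟩
      rw [map_mul, map_mul, map_inv, mul_inv_eq_one]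
      simp only [FreeGroup.lift_apply_of]
      exact hC.adjointMul_eq X.2 Y.2 h)
  have h : φ (universalDegree Z hZ.1) = 1 := by rw [hdeg, map_one]
  have h1 : φ (universalDegree Z hZ.1) = Quotient.mk _ ⟨Z, hZ.1⟩ := PresentedGroup.toGroup.of _
  rw [h1] at h
  obtain ⟨A, hA, hZA⟩ : AdjointRel Z (𝟙_ C) := Quotient.exact h
  exact hC.prop_of_isConstituent had hA (hC.isConstituent_congr hZA (ρ_ A))

theorem adjointProp_eq_top_iff :
    adjointProp C = ⊤ ↔ Subsingleton (UniversalGradingGroup C) := by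
  rw [← hC.universalGrading_one]
  constructor
  · intro h
    refine subsingleton_of_forall_eq 1 fun u => ?_
    obtain ⟨X, hX, rfl⟩ := hC.exists_universalDegree_eq u
    have h1 : universalGrading C 1 X := by
      rw [h]
      trivial
    exact h1 X hX (Simple.isConstituent_self hX)
  · intro h
    exact top_le_iff.1 fun X _ Z hZ _ => Subsingleton.elim _ _

end IsFusionCategory

end FusionGrading

/-! ### Fusion subcategories are fusion categories -/

section SplitNormal

variable {C : Type u} [Category.{v} C] [Preadditive C]

/-- In a preadditive category, a split monomorphism `f` with retraction `r` is the kernel of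
`1 - r ≫ f`. -/
theorem nonempty_normalMono_of_isSplitMono {X Y : C} (f : X ⟶ Y) [IsSplitMono f] :
    Nonempty (NormalMono f) :=
  ⟨{ Z := Y
     g := 𝟙 Y - retraction f ≫ f
     w := by simp
     isLimit := KernelFork.IsLimit.ofι' f _ fun a ha => ⟨a ≫ retraction f, by
      rw [Preadditive.comp_sub, Category.comp_id, sub_eq_zero] at ha
      rw [Category.assoc, ← ha]⟩ }⟩

theorem nonempty_normalEpi_of_isSplitEpi {X Y : C} (f : X ⟶ Y) [IsSplitEpi f] :
    Nonempty (NormalEpi f) :=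
  ⟨{ W := X
     g := 𝟙 X - f ≫ section_ f
     w := by simp
     isColimit := CokernelCofork.IsColimit.ofπ' f _ fun a ha => ⟨section_ f ≫ a, by
      rw [Preadditive.sub_comp, Category.id_comp, sub_eq_zero] at ha
      rw [← Category.assoc, ← ha]⟩ }⟩

end SplitNormal

section

variable {C : Type u} [Category.{v} C] [MonoidalCategory C]

theorem IsDual.fullSubcategory {P : ObjectProperty C} [P.IsMonoidal] {X Y : P.FullSubcategory}
    (h : IsDual X.obj Y.obj) : IsDual X Y := by
  obtain ⟨p⟩ := h
  have : ExactPairing (P.ι.obj X) (P.ι.obj Y) := p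
  exact ⟨.ofFullyFaithful P.ι X Y⟩

end

section FullSubcategory

variable {k : Type w} [Field k] {C : Type u} [Category.{v} C] [Preadditive C] [Linear k C]
  [MonoidalCategory C]

namespace IsFusionCategory

variable (hC : IsFusionCategory k C) {P : ObjectProperty C} (hP : IsFusionSubcategory P)

include hC hP

theorem isClosedUnderSubobjects : P.IsClosedUnderSubobjects where
  prop_of_mono f _ hY :=
    have := hC.isSplitMono_of_mono f
    hP.retract _ _ ⟨⟨f, retraction f, IsSplitMono.id f⟩⟩ hY

theorem isClosedUnderQuotients : P.IsClosedUnderQuotients where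
  prop_of_epi f _ hX :=
    have := hC.isSplitEpi_of_epi f
    hP.retract _ _ ⟨⟨section_ f, f, IsSplitEpi.id f⟩⟩ hX

theorem isClosedUnderFiniteProducts : P.IsClosedUnderFiniteProducts where
  isClosedUnderLimitsOfShape J _ := ⟨by
    rintro X ⟨p⟩
    refine hC.isFusionSubcategory_of_constituents hP fun Z ⟨hZ, f, hf⟩ => ?_
    obtain ⟨j, hj⟩ : ∃ j, f ≫ p.π.app j ≠ 0 := by
      by_contra! h
      exact hf (p.isLimit.hom_ext fun j => (h j).trans zero_comp.symm)
    exact hC.prop_of_isConstituent hP (p.prop_diag_obj j) ⟨hZ, _, hj⟩⟩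

theorem isSplitMono_fullSubcategory {X Y : P.FullSubcategory} (f : X ⟶ Y) [Mono f] :
    IsSplitMono f := by
  have := hC.isClosedUnderSubobjects hP
  have := hC.hasKernels
  -- The kernel in `C` lies in the subcategory, so `f` is a monomorphism in `C`.
  have hK : P (kernel f.hom) := P.prop_of_mono (kernel.ι f.hom) X.2
  let i : (⟨_, hK⟩ : P.FullSubcategory) ⟶ X := ObjectProperty.homMk (kernel.ι f.hom)
  have hi : i = 0 := zero_of_comp_mono f (P.hom_ext (kernel.condition f.hom))
  have hι : kernel.ι f.hom = 0 := congrArg (fun g => g.hom) hi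
  have : Mono f.hom := Preadditive.mono_of_kernel_zero hι
  have := hC.isSplitMono_of_mono f.hom
  exact ⟨⟨ObjectProperty.homMk (retraction f.hom), P.hom_ext (IsSplitMono.id f.hom)⟩⟩

theorem isSplitEpi_fullSubcategory {X Y : P.FullSubcategory} (f : X ⟶ Y) [Epi f] :
    IsSplitEpi f := by
  have := hC.isClosedUnderQuotients hP
  have := hC.hasCokernels
  have hQ : P (cokernel f.hom) := P.prop_of_epi (cokernel.π f.hom) Y.2
  let p : Y ⟶ (⟨_, hQ⟩ : P.FullSubcategory) := ObjectProperty.homMk (cokernel.π f.hom)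
  have hp : p = 0 := zero_of_epi_comp f (P.hom_ext (cokernel.condition f.hom))
  have hπ : cokernel.π f.hom = 0 := congrArg (fun g => g.hom) hp
  have : Epi f.hom := Preadditive.epi_of_cokernel_zero hπ
  have := hC.isSplitEpi_of_epi f.hom
  exact ⟨⟨ObjectProperty.homMk (section_ f.hom), P.hom_ext (IsSplitEpi.id f.hom)⟩⟩

theorem simple_fullSubcategory_iff {X : P.FullSubcategory} : Simple X ↔ Simple X.obj := by
  constructor
  · intro hX
    obtain ⟨S, hS⟩ := hC.exists_isConstituent (W := X.obj) fun h =>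
      Simple.not_isZero X ((IsZero.iff_id_eq_zero X).2
        (P.hom_ext ((IsZero.iff_id_eq_zero X.obj).1 h)))
    obtain ⟨r⟩ := hC.retract_of_isConstituent hS
    have hPS : P S := hP.retract _ _ ⟨r⟩ X.2
    have r' : Retract (⟨S, hPS⟩ : P.FullSubcategory) X :=
      ⟨ObjectProperty.homMk r.i, ObjectProperty.homMk r.r, P.hom_ext r.retract⟩
    have hi : r'.i ≠ 0 := fun h => by
      have := hS.1
      have h0 : 𝟙 (⟨S, hPS⟩ : P.FullSubcategory) = 0 := by rw [← r'.retract, h, zero_comp]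
      exact id_nonzero S (congrArg (fun g => g.hom) h0)
    have : Mono r'.i := inferInstance
    have : IsIso r'.i := isIso_of_mono_of_nonzero hi
    exact (Simple.iff_of_iso (P.ι.mapIso (asIso r'.i))).1 hS.1
  · intro hX
    have : P.ι.PreservesMonomorphisms := ⟨fun f _ => by
      have := hC.isSplitMono_fullSubcategory hP f
      infer_instance⟩
    have : Simple (P.ι.obj X) := hX
    exact P.ι.simple_of_simple_obj X

theorem isConstituent_fullSubcategory_iff {X Y : P.FullSubcategory} :
    IsConstituent X Y ↔ IsConstituent X.obj Y.obj := by
  refine and_congr (hC.simple_fullSubcategory_iff hP) ⟨?_, ?_⟩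
  · rintro ⟨f, hf⟩
    exact ⟨f.hom, fun h => hf (P.hom_ext h)⟩
  · rintro ⟨f, hf⟩
    exact ⟨ObjectProperty.homMk f, fun h => hf (congrArg (fun g => g.hom) h)⟩

/-- A fusion subcategory of a fusion category is a fusion category. -/
theorem fullSubcategory [P.IsMonoidal] : IsFusionCategory k P.FullSubcategory where
  hasFiniteProducts :=
    have := hC.hasFiniteProducts
    have := hC.isClosedUnderFiniteProducts hP
    inferInstance
  hasKernels :=
    have := hC.hasKernels
    have := hC.isClosedUnderSubobjects hP
    inferInstance
  hasCokernels :=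
    have := hC.hasCokernels
    have := hC.isClosedUnderQuotients hP
    inferInstance
  normalMono := ⟨fun f _ =>
    have := hC.isSplitMono_fullSubcategory hP f
    nonempty_normalMono_of_isSplitMono f⟩
  normalEpi := ⟨fun f _ =>
    have := hC.isSplitEpi_fullSubcategory hP f
    nonempty_normalEpi_of_isSplitEpi f⟩
  rigid X := by
    obtain ⟨⟨D, hD⟩, E, hE⟩ := hC.rigid X.obj
    exact ⟨⟨⟨D, (hP.dual _ _ hD).1 X.2⟩, hD.fullSubcategory⟩,
      ⟨⟨E, (hP.dual _ _ hE).2 X.2⟩, hE.fullSubcategory⟩⟩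
  semisimple X := by
    obtain ⟨m, S, ι, π, hS, h1, h0, h2⟩ := isDirectSumOf_iff.1 (hC.semisimple X.obj)
    have hPS : ∀ i, P (S i) := fun i => hP.retract _ _ ⟨⟨ι i, π i, h1 i⟩⟩ X.2
    refine isDirectSumOf_iff.2 ⟨m, fun i => ⟨S i, hPS i⟩, fun i => ObjectProperty.homMk (ι i),
      fun i => ObjectProperty.homMk (π i), fun i => (hC.simple_fullSubcategory_iff hP).2 (hS i),
      fun i => P.hom_ext (h1 i), fun i j hij => P.hom_ext (h0 i j hij), P.ι.map_injective ?_⟩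
    rw [Functor.map_sum]
    exact h2
  finiteSimples := by
    classical
    obtain ⟨m, S, hS⟩ := hC.finiteSimples
    refine ⟨m, fun i => if h : P (S i) then ⟨S i, h⟩ else 𝟙_ _, fun X hX => ?_⟩
    obtain ⟨i, ⟨e⟩⟩ := hS X.obj ((hC.simple_fullSubcategory_iff hP).1 hX)
    have h : P (S i) := hP.congr e X.2
    refine ⟨i, ?_⟩
    simp only [dif_pos h]
    exact ⟨P.isoMk e⟩
  finiteHom X Y :=
    have : Module.Finite k (P.ι.obj X ⟶ P.ι.obj Y) := hC.finiteHom X.obj Y.obj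
    Module.Finite.of_injective (P.ι.mapLinearMap k : (X ⟶ Y) →ₗ[k] _) P.ι.map_injective
  unitSimple := (hC.simple_fullSubcategory_iff hP).2 hC.unitSimple

theorem isNonInvSimple_fullSubcategory_iff [MonoidalPreadditive C] [P.IsMonoidal]
    {X : P.FullSubcategory} : IsNonInvSimple X ↔ IsNonInvSimple X.obj := by
  have hD := hC.fullSubcategory hP
  unfold IsNonInvSimple
  rw [hC.simple_fullSubcategory_iff hP, and_congr_right_iff, not_iff_not]
  intro hX
  rw [hC.isInvertible_iff hX, hD.isInvertible_iff ((hC.simple_fullSubcategory_iff hP).2 hX)]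
  constructor
  · rintro ⟨Y, ⟨e⟩⟩
    exact ⟨Y.obj, ⟨P.ι.mapIso e⟩⟩
  · rintro ⟨Y, ⟨e⟩⟩
    exact ⟨⟨Y, (hP.dual _ _ (hC.isDual_of_tensor_iso_unit hX e)).1 X.2⟩, ⟨P.isoMk e⟩⟩

end IsFusionCategory

end FullSubcategory

/-! ### Generalized near-group categories -/

section Units

variable {C : Type u} [Category.{v} C] [MonoidalCategory C]

/-- Transitivity of the action of `G(C)` in terms of objects. -/
theorem exists_invGroup_mul_eq_iff {X Y : C} :
    (∃ g : InvGroup C, (g : Skeleton C) * toSkeleton X = toSkeleton Y) ↔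
      ∃ L M : C, Nonempty (L ⊗ M ≅ 𝟙_ C) ∧ Nonempty (M ⊗ L ≅ 𝟙_ C) ∧ Nonempty (L ⊗ X ≅ Y) := by
  simp only [← toSkeleton_eq_toSkeleton_iff, Skeleton.toSkeleton_tensorObj, ← Skeleton.one_eq]
  constructor
  · rintro ⟨g, hg⟩
    have h (s : Skeleton C) : toSkeleton ((fromSkeleton C).obj s) = s :=
      toSkeleton_fromSkeleton_obj s
    refine ⟨(fromSkeleton C).obj g, (fromSkeleton C).obj (g⁻¹ : InvGroup C), ?_⟩
    simp only [h]
    exact ⟨g.mul_inv, g.inv_mul, hg⟩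
  · rintro ⟨L, M, h1, h2, h3⟩
    exact ⟨⟨toSkeleton L, toSkeleton M, h1, h2⟩, h3⟩

end Units

section NearGroup

variable {k : Type w} [Field k] {C : Type u} [Category.{v} C] [Preadditive C] [Linear k C]
  [MonoidalCategory C] [MonoidalPreadditive C]

namespace IsGeneralizedNearGroup

variable (h : IsGeneralizedNearGroup k C)

include h

/-- If the non-invertible simple object `X₁` is such that `X₁ ⊗ X₁^*` has only invertible
constituents, then so has every product `X ⊗ Y` of non-invertible simple objects: writing
`Y ≅ L ⊗ X₁^*` and `X ⊗ L ≅ L' ⊗ X₁` with `L`, `L'` invertible gives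
`X ⊗ Y ≅ L' ⊗ (X₁ ⊗ X₁^*)`. -/
theorem isInvertible_of_isConstituent_tensor {X₁ D₁ X Y Z : C} (hX₁ : IsNonInvSimple X₁)
    (hD₁ : IsDual X₁ D₁) (h₁ : ∀ Z, IsConstituent Z (X₁ ⊗ D₁) → IsInvertible Z)
    (hX : IsNonInvSimple X) (hY : IsNonInvSimple Y) (hZ : IsConstituent Z (X ⊗ Y)) :
    IsInvertible Z := by
  have hC := h.fusion
  by_contra hZi
  obtain ⟨L, M, ⟨e⟩, ⟨e'⟩, ⟨i⟩⟩ := exists_invGroup_mul_eq_iff.1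
    (h.transitive D₁ Y (hC.isNonInvSimple_dual hD₁ hX₁) hY)
  obtain ⟨L', M', ⟨a⟩, ⟨a'⟩, ⟨j⟩⟩ := exists_invGroup_mul_eq_iff.1
    (h.transitive X₁ (X ⊗ L) hX₁ (hC.isNonInvSimple_tensor_right e hX))
  let s : X ⊗ Y ≅ L' ⊗ (X₁ ⊗ D₁) := whiskerLeftIso X i.symm ≪≫ (α_ X L D₁).symm ≪≫
    whiskerRightIso j.symm D₁ ≪≫ α_ L' X₁ D₁
  let t : M' ⊗ (L' ⊗ (X₁ ⊗ D₁)) ≅ X₁ ⊗ D₁ :=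
    (α_ M' L' _).symm ≪≫ whiskerRightIso a' _ ≪≫ λ_ _
  have hMZ := hC.isNonInvSimple_tensor_left a' a ⟨hZ.1, hZi⟩
  obtain ⟨r⟩ := hC.retract_of_isConstituent (hC.isConstituent_congr hZ s)
  exact hMZ.2 (h₁ _ (.of_retract hMZ.1 ((r.map (tensorLeft M')).trans (.ofIso t))))

/-- A fusion subcategory with a non-invertible simple object is again generalized near-group: an
invertible `L` with `L ⊗ X ≅ Y` lies in every fusion subcategory containing `X` and `Y`, because it
occurs in `Y ⊗ X^*`. -/
theorem fullSubcategory {P : ObjectProperty C} [P.IsMonoidal] (hP : IsFusionSubcategory P)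
    {X₀ : C} (hX₀ : IsNonInvSimple X₀) (hPX₀ : P X₀) :
    IsGeneralizedNearGroup k P.FullSubcategory where
  fusion := h.fusion.fullSubcategory hP
  nonPointed := ⟨⟨X₀, hPX₀⟩, (h.fusion.isNonInvSimple_fullSubcategory_iff hP).2 hX₀⟩
  transitive X Y hX hY := by
    have hC := h.fusion
    rw [hC.isNonInvSimple_fullSubcategory_iff hP] at hX hY
    obtain ⟨L, M, ⟨e⟩, ⟨e'⟩, ⟨i⟩⟩ := exists_invGroup_mul_eq_iff.1 (h.transitive _ _ hX hY)
    obtain ⟨D, hD⟩ := (hC.rigid X.obj).1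
    have hL := hC.simple_of_tensor_iso_unit e'
    have hLY := (hC.isConstituent_tensor_right_iff hD hL hY.1).1 (.of_retract hY.1 (.ofIso i.symm))
    have hPL : P L := hC.prop_of_isConstituent hP
      (hP.tensor _ _ Y.2 ((hP.dual _ _ hD).1 X.2)) hLY
    have hPM : P M := (hP.dual _ _ (hC.isDual_of_tensor_iso_unit hL e)).1 hPL
    exact exists_invGroup_mul_eq_iff.2
      ⟨⟨L, hPL⟩, ⟨M, hPM⟩, ⟨P.isoMk e⟩, ⟨P.isoMk e'⟩, ⟨P.isoMk i⟩⟩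

/-- If `X₀` is a non-invertible simple object, then `X ⊗ X^* ≅ X₀ ⊗ X₀^*` for every non-invertible
simple object `X`: indeed `X^* ≅ L ⊗ X₀^*` for some invertible `L`, hence `X ≅ X₀ ⊗ L^*`. -/
theorem tensor_dual_iso {X₀ D₀ X D : C} (hX₀ : IsNonInvSimple X₀) (hD₀ : IsDual X₀ D₀)
    (hX : IsNonInvSimple X) (hD : IsDual X D) : Nonempty (X ⊗ D ≅ X₀ ⊗ D₀) := by
  have hC := h.fusion
  obtain ⟨L, M, ⟨e⟩, ⟨e'⟩, ⟨i⟩⟩ := exists_invGroup_mul_eq_iff.1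
    (h.transitive D₀ D (hC.isNonInvSimple_dual hD₀ hX₀) (hC.isNonInvSimple_dual hD hX))
  have hM := hC.simple_of_tensor_iso_unit e
  obtain ⟨p⟩ := hC.isDual_of_tensor_iso_unit hM e'
  obtain ⟨p₀⟩ := hD₀
  have hD' : IsDual (X₀ ⊗ M) (L ⊗ D₀) := ⟨inferInstance⟩
  obtain ⟨j⟩ := (hD.congr_right i.symm).iso_left hD'
  exact ⟨whiskerRightIso j D ≪≫ whiskerLeftIso (X₀ ⊗ M) i.symm ≪≫ α_ X₀ M (L ⊗ D₀) ≪≫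
    whiskerLeftIso X₀ ((α_ M L D₀).symm ≪≫ whiskerRightIso e' D₀ ≪≫ λ_ D₀)⟩

/-- If the adjoint subcategory of `C` contains a non-invertible simple object `X₀`, then it is its
own adjoint subcategory: by `tensor_dual_iso` the products `X ⊗ X^*` with `X` simple in `C` are
either trivial or isomorphic to `X₀ ⊗ X₀^*`. -/
theorem adjointProp_adjointSubcategory {X₀ : C} (hX₀ : IsNonInvSimple X₀)
    (hadX₀ : adjointProp C X₀) : adjointProp (AdjointSubcategory C) = ⊤ := by
  have hC := h.fusion
  have had := adjointProp_isFusionSubcategory (C := C)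
  refine top_le_iff.1 fun Y _ Q hQ hgen => ?_
  have hP : IsFusionSubcategory (C := C)
      (fun Z => ∃ hZ : adjointProp C Z, Q ⟨Z, hZ⟩) := by
    refine ⟨⟨had.unit, hQ.unit⟩, ?_, ?_, ?_, ?_⟩
    · rintro X Y ⟨hX, hQX⟩ ⟨hY, hQY⟩
      exact ⟨had.tensor _ _ hX hY, hQ.tensor _ _ hQX hQY⟩
    · rintro X Y ⟨r⟩ ⟨hY, hQY⟩
      have hX := had.retract X Y ⟨r⟩ hY
      exact ⟨hX, hQ.retract ⟨X, hX⟩ ⟨Y, hY⟩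
        ⟨⟨ObjectProperty.homMk r.i, ObjectProperty.homMk r.r,
          (adjointProp C).hom_ext r.retract⟩⟩ hQY⟩
    · intro X hX
      have hadX := had.directSum X (hX.mono fun _ hZ => hZ.1)
      refine ⟨hadX, (hC.fullSubcategory had).isFusionSubcategory_of_constituents hQ
        fun Z hZ => ?_⟩
      rw [hC.isConstituent_fullSubcategory_iff had] at hZ
      obtain ⟨V, ⟨hV, hQV⟩, hZV⟩ := hZ.exists_of_isDirectSumOf hX
      exact (hC.fullSubcategory had).prop_of_isConstituent hQ hQV
        ((hC.isConstituent_fullSubcategory_iff had (Y := ⟨V, hV⟩)).2 hZV)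
    · intro X D hD
      constructor
      · rintro ⟨hX, hQX⟩
        have hadD := (had.dual _ _ hD).1 hX
        exact ⟨hadD, (hQ.dual ⟨X, hX⟩ ⟨D, hadD⟩
          hD.fullSubcategory).1 hQX⟩
      · rintro ⟨hadD, hQD⟩
        have hX := (had.dual _ _ hD).2 hadD
        exact ⟨hX, (hQ.dual ⟨X, hX⟩ ⟨D, hadD⟩
          hD.fullSubcategory).2 hQD⟩
  refine (Y.2 _ hP fun X D Z hX hD hZ => ?_).2
  refine ⟨adjointProp_tensor_dual hX hD hZ, ?_⟩
  by_cases hXi : IsInvertible X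
  · obtain ⟨D', hD', ⟨e⟩⟩ := hXi
    obtain ⟨i⟩ := hD.iso_right hD'
    obtain ⟨j⟩ := hC.iso_of_isConstituent
      (hC.isConstituent_congr hZ (whiskerLeftIso X i ≪≫ e)) hC.unitSimple
    exact hQ.congr (X := 𝟙_ _) ((adjointProp C).isoMk j.symm) hQ.unit
  · obtain ⟨D₀, hD₀⟩ := (hC.rigid X₀).1
    have hadD₀ := (had.dual _ _ hD₀).1 hadX₀
    obtain ⟨e⟩ := h.tensor_dual_iso hX₀ hD₀ ⟨hX, hXi⟩ hD
    refine hgen ⟨X₀, hadX₀⟩ ⟨D₀, hadD₀⟩ _ ((hC.simple_fullSubcategory_iff had).2 hX₀.1)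
      hD₀.fullSubcategory
      ((hC.isConstituent_fullSubcategory_iff had).2 (hC.isConstituent_congr hZ e))

end IsGeneralizedNearGroup

end NearGroup

end GenNearGroup

open GenNearGroup in
theorem theorem3p7 {k : Type w} [Field k] [IsAlgClosed k] [CharZero k]
    {C : Type u} [Category.{v} C] [Preadditive C] [Linear k C] [MonoidalCategory C]
    [MonoidalPreadditive C] [MonoidalLinear k C]
    {n : ℕ} (Γ : Subgroup (InvGroup C)) (κ : Fin n → ℕ)
    (hC : IsGeneralizedNearGroupOfType k C Γ κ) :
    ((∀ i, κ i = 0) → IsGeneralizedTambaraYamagami k C) ∧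
    ((∃ i, κ i ≠ 0) →
      -- the adjoint subcategory is a (non-pointed) generalized near-group fusion category
      IsGeneralizedNearGroup k (AdjointSubcategory C) ∧
      -- the universal grading of the whole category is a faithful grading by a finite group, with
      -- trivial component the adjoint subcategory
      IsGrading (universalGrading C) ∧ IsFaithfulGrading (universalGrading C) ∧
      universalGrading C 1 = adjointProp C ∧
      -- the adjoint subcategory is proper unless the universal grading group is trivial
      (adjointProp C = ⊤ ↔ Subsingleton (UniversalGradingGroup C)) ∧
      -- the universal grading of the adjoint subcategory is trivial
      Subsingleton (UniversalGradingGroup (AdjointSubcategory C)) ∧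
      adjointProp (AdjointSubcategory C) = ⊤) := by
  have hG := hC.isGeneralizedNearGroup
  have hF := hG.fusion
  obtain ⟨hn, X, D, hX, -, hXall, -, hD, hκ⟩ := hC.exists_data
  refine ⟨fun h0 => ⟨hF, hG.nonPointed, fun Y Z hY hZ => ?_⟩, fun ⟨i, hi⟩ => ?_⟩
  · refine hF.isDirectSumOf_of_isConstituent fun W hW => ⟨hW.1, ?_⟩
    refine hG.isInvertible_of_isConstituent_tensor (hX ⟨0, hn⟩) hD (fun V hV => ?_) hY hZ hW
    by_contra hVi
    obtain ⟨i, ⟨e⟩⟩ := hXall V ⟨hV.1, hVi⟩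
    obtain ⟨-, f, hf⟩ := hV
    have := hF.finiteHom (X i) (X ⟨0, hn⟩ ⊗ D)
    have hs := Module.finrank_zero_iff.1 ((hκ i).symm.trans (h0 i))
    refine hf ?_
    rw [← cancel_epi e.inv]
    exact hs.elim _ _
  · obtain ⟨f, hf⟩ : ∃ f : X i ⟶ X ⟨0, hn⟩ ⊗ D, f ≠ 0 := by
      by_contra! h
      have : Subsingleton (X i ⟶ X ⟨0, hn⟩ ⊗ D) := subsingleton_of_forall_eq 0 h
      exact hi ((hκ i).trans Module.finrank_zero_of_subsingleton)
    have had : adjointProp C (X i) :=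
      adjointProp_tensor_dual (hX ⟨0, hn⟩).1 hD ⟨(hX i).1, f, hf⟩
    have hN := hG.fullSubcategory adjointProp_isFusionSubcategory (hX i) had
    have htop := hG.adjointProp_adjointSubcategory (hX i) had
    exact ⟨hN, hF.isGrading_universalGrading, hF.isFaithfulGrading_universalGrading,
      hF.universalGrading_one, hF.adjointProp_eq_top_iff,
      hN.fusion.adjointProp_eq_top_iff.1 htop, htop⟩
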